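/- Let $m\ge 3$ and let $(\mathbb H,g_{\mathbb H})$ be $m$-dimensional hyperbolic space (curvature $-1$). There exists a constant $C_m>0$, depending only on $m$, such that the following holds. Let $\Omega\subseteq\mathbb H$ be an open set containing an open metric ball $B_{r_0}=B_{r_0}(p)$ with arbitrary centre $p\in\mathbb H$ and radius $r_0>1$, let $T\in\,]0,\infty]$, and let $(g(t))_{t\in[0,T[}$ be a Yamabe flow on $\Omega$, that is, a family of Riemannian metrics on $\Omega$, of class $C^{2;1}$ on $\Omega\times[0,T[$ ($C^2$ in space, $C^1$ in time, with these derivatives continuous on $\Omega\times[0,T[$), satisfying $\frac{\partial}{\partial t}g(t)=-R_{g(t)}\,g(t)$ for all $t\in[0,T[$, where $R_{g}$ is the scalar curvature of $g$. Suppose that $g(t)=u(\cdot,t)\,g_{\mathbb H}|_\Omega$ for a function $u$ on $\Omega\times[0,T[$. Then for all $t\in[0,T[$ $$u(\cdot,t)\;\ge\;\inf_{B_{r_0}}u(\cdot,0)-C_m\,t\qquad\text{in } B_{r_0-1}=B_{r_0-1}(p).$$ No completeness of $g(t)$, no bound on its curvature, and no control of $u$ near the boundary of $\Omega$ is assumed.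 -/

import Mathlib

open scoped BigOperators

noncomputable section

namespace YamabeHyp

/-- The coordinate space `ℝ^m` with its Euclidean norm. -/
abbrev Coord (m : ℕ) : Type := EuclideanSpace ℝ (Fin m)

/-- A field of (component matrices of) bilinear forms in the global coordinates. On an open set
where it is symmetric and positive definite it is a Riemannian metric there. -/
abbrev MetricField (m : ℕ) : Type := Coord m → Matrix (Fin m) (Fin m) ℝ

variable {m : ℕ}

/-- The partial derivative `∂_k f` at `x`. -/
def pd (k : Fin m) (f : Coord m → ℝ) (x : Coord m) : ℝ :=
  fderiv ℝ f x (EuclideanSpace.single k 1)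

/-- Christoffel symbols of the Levi-Civita connection,
`Γ^k_{ij} = (1/2) ∑_l g^{kl} (∂_i g_{jl} + ∂_j g_{il} - ∂_l g_{ij})`. -/
def christoffel (g : MetricField m) (k i j : Fin m) (x : Coord m) : ℝ :=
  (1 / 2 : ℝ) * ∑ l, (g x)⁻¹ k l *
    (pd i (fun y => g y j l) x + pd j (fun y => g y i l) x - pd l (fun y => g y i j) x)

/-- The Riemann curvature tensor: `R(∂_k, ∂_l) ∂_j = ∑_i R^i_{jkl} ∂_i`, that is
`R^i_{jkl} = ∂_k Γ^i_{lj} - ∂_l Γ^i_{kj} + ∑_p (Γ^i_{kp} Γ^p_{lj} - Γ^i_{lp} Γ^p_{kj})`. -/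
def riemann (g : MetricField m) (i j k l : Fin m) (x : Coord m) : ℝ :=
  pd k (christoffel g i l j) x - pd l (christoffel g i k j) x
    + ∑ p, (christoffel g i k p x * christoffel g p l j x
      - christoffel g i l p x * christoffel g p k j x)

/-- The Ricci tensor, `Ric_{jl} = ∑_k R^k_{jkl}`. -/
def ricci (g : MetricField m) (j l : Fin m) (x : Coord m) : ℝ :=
  ∑ k, riemann g k j k l x

/-- The scalar curvature `R_g = ∑_{j,l} g^{jl} Ric_{jl}`. -/
def scalarCurvature (g : MetricField m) (x : Coord m) : ℝ :=
  ∑ j, ∑ l, (g x)⁻¹ j l * ricci g j l x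

/-- The underlying set of hyperbolic space in the Poincaré ball model. -/
def hypSpace (m : ℕ) : Set (Coord m) := Metric.ball 0 1

/-- The hyperbolic metric of curvature `-1` in the Poincaré ball model,
`g_ℍ = 4 (1 - |x|²)⁻² ∑ (dx^i)²`. -/
def hypMetric (m : ℕ) : MetricField m := fun x =>
  (4 / (1 - ‖x‖ ^ 2) ^ 2) • (1 : Matrix (Fin m) (Fin m) ℝ)

/-- The speed `|γ'(s)|_g` of a curve. -/
def speed (g : MetricField m) (γ : ℝ → Coord m) (s : ℝ) : ℝ :=
  Real.sqrt (∑ i, ∑ j, g (γ s) i j * deriv γ s i * deriv γ s j)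

/-- `γ : [a, b] → S` is a piecewise `C¹` curve in `S` from `p` to `q`. -/
def IsPiecewiseC1Curve (S : Set (Coord m)) (p q : Coord m) (γ : ℝ → Coord m) (a b : ℝ) : Prop :=
  γ a = p ∧ γ b = q ∧ a ≤ b ∧ (∀ s ∈ Set.Icc a b, γ s ∈ S) ∧
    ∃ (n : ℕ) (τ : ℕ → ℝ), Monotone τ ∧ τ 0 = a ∧ τ n = b ∧
      ∀ i < n, ContDiffOn ℝ 1 γ (Set.Icc (τ i) (τ (i + 1)))

/-- The Riemannian distance of `(S, g)`: the infimum of the lengths of the piecewise `C¹` curves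
in `S` joining two points. -/
def riemDist (S : Set (Coord m)) (g : MetricField m) (p q : Coord m) : ℝ :=
  sInf {L : ℝ | ∃ (γ : ℝ → Coord m) (a b : ℝ),
    IsPiecewiseC1Curve S p q γ a b ∧ L = ∫ s in a..b, speed g γ s}

/-- The open metric ball `B_r(p)` of hyperbolic space. -/
def hypBall (m : ℕ) (p : Coord m) (r : ℝ) : Set (Coord m) :=
  {x | x ∈ hypSpace m ∧ riemDist (hypSpace m) (hypMetric m) p x < r}

/-- The time interval `[0, T[`, where `T` may be `∞`. -/
def timeInterval (T : EReal) : Set ℝ := {t | 0 ≤ t ∧ (t : EReal) < T}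

/-- `(g(t))_{t ∈ [0, T[}` is a Yamabe flow on the open set `Ω`: a family of Riemannian metrics of
class `C^{2;1}` on `Ω × [0, T[` with `∂g/∂t = -R_{g(t)} g(t)` (one-sided derivative at `t = 0`).
Continuity of the time derivative is not listed since it follows from the equation. -/
structure IsYamabeFlow (Ω : Set (Coord m)) (T : EReal) (g : ℝ → MetricField m) : Prop where
  posDef : ∀ t ∈ timeInterval T, ∀ x ∈ Ω, (g t x).PosDef
  contDiffOn : ∀ t ∈ timeInterval T, ∀ i j, ContDiffOn ℝ 2 (fun x => g t x i j) Ω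
  continuousOn : ∀ i j,
    ContinuousOn (fun z : Coord m × ℝ => g z.2 z.1 i j) (Ω ×ˢ timeInterval T)
  continuousOn_pd : ∀ i j k,
    ContinuousOn (fun z : Coord m × ℝ => pd k (fun y => g z.2 y i j) z.1) (Ω ×ˢ timeInterval T)
  continuousOn_pd_pd : ∀ i j k l,
    ContinuousOn (fun z : Coord m × ℝ => pd l (pd k (fun y => g z.2 y i j)) z.1)
      (Ω ×ˢ timeInterval T)
  equation : ∀ t ∈ timeInterval T, ∀ x ∈ Ω, ∀ i j,
    HasDerivWithinAt (fun s => g s x i j) (-scalarCurvature (g t) x * g t x i j)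
      (timeInterval T) t

end YamabeHyp

end

/-! ### Hyperbolic lengths and nearby Euclidean balls -/

namespace YamabeHyp

open MeasureTheory Set

variable {m : ℕ}

/-! The proof is a comparison with an explicit barrier in the Poincaré ball. Writing `g = v δ`, the
flow reads `∂ₜv = (m-1)(Δ log v + (m-2)/4 |∇ log v|²)` (`scalarCurvature_conformal`). The right side
does not change when `v` is multiplied by a positive constant, so a barrier `c(t) b(y)` has a
spatial speed independent of `c`; this is why the loss is linear in `t`.

Around each `x` take `b = η^16 · 4(1-|y|²)⁻²` with `η = 1 - 64|y-x|²/(1-|x|²)²`. The cutoff `η`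
vanishes on the boundary of a Euclidean ball that lies within hyperbolic distance 1 of `x`
(`mem_hypBall_of_norm_sub_le`), so only the initial values on `B_{r₀}` enter. The speed of `b`
exceeds `-C_m b`: near the zeros of `η` the gradient term dominates and the speed is nonnegative,
and elsewhere `η` is bounded below, so a large constant suffices (`barrierLog_operator_ge`,
`barrier_scalar_inequality`).

If `v` falls below `(I - C_m t) b`, there is a first contact (`exists_first_zero`). It is interior,
since `v > 0 = b` where `η = 0`. There the gradients of the logarithms agree and their second
derivatives are ordered, so `∂ₜv > -C_m b`, while first contact forces `∂ₜv ≤ -C_m b`. -/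

lemma hypMetric_sum (y w : Coord m) :
    ∑ i, ∑ j, hypMetric m y i j * w i * w j = 4 / (1 - ‖y‖ ^ 2) ^ 2 * ‖w‖ ^ 2 := by
  simp only [hypMetric, Matrix.smul_apply, Matrix.one_apply, smul_eq_mul, mul_ite, mul_one,
    mul_zero, ite_mul, zero_mul, Finset.sum_ite_eq, Finset.mem_univ, if_true,
    EuclideanSpace.real_norm_sq_eq, Finset.mul_sum]
  exact Finset.sum_congr rfl fun i _ => by ring

lemma speed_hypMetric (γ : ℝ → Coord m) (s : ℝ) :
    speed (hypMetric m) γ s = Real.sqrt (4 / (1 - ‖γ s‖ ^ 2) ^ 2 * ‖deriv γ s‖ ^ 2) := by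
  rw [speed, hypMetric_sum]

lemma one_sub_norm_sq_pos {y : Coord m} (hy : y ∈ hypSpace m) : 0 < 1 - ‖y‖ ^ 2 := by
  rw [hypSpace, mem_ball_zero_iff] at hy
  nlinarith [norm_nonneg y]

/-- `deriv γ` is uncontrolled at the endpoints, but it agrees on the open interval with
`derivWithin`, which is continuous up to them. -/
lemma intervalIntegrable_speed_of_contDiffOn {γ : ℝ → Coord m} {a b : ℝ} (hab : a ≤ b)
    (hγ : ContDiffOn ℝ 1 γ (Icc a b)) (hS : ∀ s ∈ Icc a b, γ s ∈ hypSpace m) :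
    IntervalIntegrable (speed (hypMetric m) γ) volume a b := by
  rcases hab.eq_or_lt with rfl | hlt
  · exact IntervalIntegrable.refl
  have hd := hγ.continuousOn_derivWithin (uniqueDiffOn_Icc hlt) le_rfl
  have hc : ContinuousOn (fun s => Real.sqrt (4 / (1 - ‖γ s‖ ^ 2) ^ 2 *
      ‖derivWithin γ (Icc a b) s‖ ^ 2)) (Icc a b) := by
    refine (ContinuousOn.mul (continuousOn_const.div ?_ ?_) (hd.norm.pow 2)).sqrt
    · exact (continuousOn_const.sub (hγ.continuousOn.norm.pow 2)).pow 2
    · intro s hs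
      exact (pow_pos (one_sub_norm_sq_pos (hS s hs)) 2).ne'
  rw [intervalIntegrable_iff_integrableOn_Ioo_of_le hab]
  refine (hc.integrableOn_Icc.mono_set Ioo_subset_Icc_self).congr_fun ?_ measurableSet_Ioo
  intro s hs
  simp only [speed_hypMetric, derivWithin_of_mem_nhds (Icc_mem_nhds hs.1 hs.2)]

lemma IsPiecewiseC1Curve.intervalIntegrable_speed {p q : Coord m} {γ : ℝ → Coord m} {a b : ℝ}
    (h : IsPiecewiseC1Curve (hypSpace m) p q γ a b) :
    IntervalIntegrable (speed (hypMetric m) γ) volume a b := by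
  obtain ⟨-, -, -, hS, n, τ, hτ, rfl, rfl, hC⟩ := h
  refine IntervalIntegrable.trans_iterate fun k hk => ?_
  refine intervalIntegrable_speed_of_contDiffOn (hτ k.le_succ) (hC k hk) fun s hs => hS s ?_
  exact ⟨(hτ k.zero_le).trans hs.1, hs.2.trans (hτ hk)⟩

lemma isPiecewiseC1Curve_segment {S : Set (Coord m)} {p q : Coord m}
    (h : ∀ s ∈ Icc (0 : ℝ) 1, p + s • (q - p) ∈ S) :
    IsPiecewiseC1Curve S p q (fun s => p + s • (q - p)) 0 1 := by
  refine ⟨by simp, by simp, zero_le_one, h, 1, fun i => if i = 0 then 0 else 1, ?_, by simp,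
    by simp, fun i _ => ?_⟩
  · intro i j hij
    by_cases hi : i = 0
    · by_cases hj : j = 0 <;> simp [hi, hj]
    · have hj : j ≠ 0 := by omega
      simp [hi, hj]
  · exact ContDiff.contDiffOn (by fun_prop)

/-- A piecewise `C¹` curve followed by a segment parametrized on an interval of length `1`. -/
noncomputable def appendSegment (γ : ℝ → Coord m) (b : ℝ) (x y : Coord m) (s : ℝ) : Coord m :=
  if s ≤ b then γ s else x + (s - b) • (y - x)

lemma IsPiecewiseC1Curve.appendSegment {S : Set (Coord m)} {p x y : Coord m} {γ : ℝ → Coord m}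
    {a b : ℝ} (h : IsPiecewiseC1Curve S p x γ a b)
    (hseg : ∀ s ∈ Icc (0 : ℝ) 1, x + s • (y - x) ∈ S) :
    IsPiecewiseC1Curve S p y (appendSegment γ b x y) a (b + 1) := by
  obtain ⟨ha, hb, hab, hS, n, τ, hτ, hτ0, hτn, hC⟩ := h
  refine ⟨by simp [YamabeHyp.appendSegment, hab, ha], by simp [YamabeHyp.appendSegment],
    by linarith, ?_,
    n + 1, fun i => if i ≤ n then τ i else b + 1, ?_, by simp [hτ0], by simp, ?_⟩
  · intro s hs
    by_cases hsb : s ≤ b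
    · simpa [YamabeHyp.appendSegment, hsb] using hS s ⟨hs.1, hsb⟩
    · simp only [YamabeHyp.appendSegment, hsb, if_false]
      exact hseg _ ⟨by linarith, by linarith [hs.2]⟩
  · intro i j hij
    by_cases hj : j ≤ n
    · have hi : i ≤ n := hij.trans hj
      simpa [hi, hj] using hτ hij
    · by_cases hi : i ≤ n
      · have := hτ hi
        simp only [hi, hj, if_true, if_false]
        linarith
      · simp [hi, hj]
  · intro i hi
    rcases (Nat.lt_succ_iff.1 hi).lt_or_eq with hlt | rfl
    · have h1 : i ≤ n := hlt.le
      have h2 : i + 1 ≤ n := hlt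
      simp only [h1, h2, if_true]
      refine (hC i hlt).congr fun s hs => ?_
      have : s ≤ b := hs.2.trans (hτn ▸ hτ h2)
      simp [YamabeHyp.appendSegment, this]
    · simp only [le_refl, if_true, hτn, show ¬ (i + 1 ≤ i) by omega, if_false]
      have : ContDiff ℝ 1 fun s : ℝ => x + (s - b) • (y - x) := by fun_prop
      refine this.contDiffOn.congr fun s hs => ?_
      by_cases hsb : s ≤ b
      · have : s = b := le_antisymm hsb hs.1
        simp [YamabeHyp.appendSegment, this, hb]
      · simp [YamabeHyp.appendSegment, hsb]

lemma speed_appendSegment_of_lt (g : MetricField m) (γ : ℝ → Coord m) (b : ℝ) (x y : Coord m)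
    {s : ℝ} (hs : s < b) : speed g (appendSegment γ b x y) s = speed g γ s := by
  have he : appendSegment γ b x y =ᶠ[nhds s] γ := by
    filter_upwards [Iio_mem_nhds hs] with r hr
    simp [appendSegment, le_of_lt (mem_Iio.1 hr)]
  simp only [speed, he.deriv_eq, he.eq_of_nhds]

lemma speed_appendSegment_of_gt (γ : ℝ → Coord m) (b : ℝ) (x y : Coord m)
    {s : ℝ} (hs : b < s) : speed (hypMetric m) (appendSegment γ b x y) s =
      Real.sqrt (4 / (1 - ‖x + (s - b) • (y - x)‖ ^ 2) ^ 2 * ‖y - x‖ ^ 2) := by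
  have he : appendSegment γ b x y =ᶠ[nhds s] fun s => x + (s - b) • (y - x) := by
    filter_upwards [Ioi_mem_nhds hs] with r hr
    simp [appendSegment, not_le.2 (mem_Ioi.1 hr)]
  have hd : HasDerivAt (fun s => x + (s - b) • (y - x)) ((1 : ℝ) • (y - x)) s :=
    (((hasDerivAt_id s).sub_const b).smul_const (y - x)).const_add x
  rw [speed_hypMetric, he.deriv_eq, he.eq_of_nhds, hd.deriv, one_smul]

lemma speed_nonneg (g : MetricField m) (γ : ℝ → Coord m) (s : ℝ) : 0 ≤ speed g γ s :=
  Real.sqrt_nonneg _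

lemma riemDist_lengths_bddBelow (S : Set (Coord m)) (g : MetricField m) (p q : Coord m) :
    BddBelow {L : ℝ | ∃ (γ : ℝ → Coord m) (a b : ℝ),
      IsPiecewiseC1Curve S p q γ a b ∧ L = ∫ s in a..b, speed g γ s} := by
  refine ⟨0, ?_⟩
  rintro L ⟨γ, a, b, h, rfl⟩
  exact intervalIntegral.integral_nonneg h.2.2.1 fun s _ => speed_nonneg g γ s

/-- Points at Euclidean distance at most `(1 - |x|²) / 8` from `x` have conformal factor
comparable to the one at `x`. -/
lemma one_sub_norm_sq_comparable {x y : Coord m} (hx : x ∈ hypSpace m)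
    (hy : ‖y - x‖ ≤ (1 - ‖x‖ ^ 2) / 8) :
    y ∈ hypSpace m ∧ 3 / 4 * (1 - ‖x‖ ^ 2) ≤ 1 - ‖y‖ ^ 2 ∧
      1 - ‖y‖ ^ 2 ≤ 5 / 4 * (1 - ‖x‖ ^ 2) := by
  have hA := one_sub_norm_sq_pos hx
  have hx1 : ‖x‖ < 1 := by simpa [hypSpace] using hx
  have h1 : ‖y‖ - ‖x‖ ≤ ‖y - x‖ := norm_sub_norm_le y x
  have h2 : ‖x‖ - ‖y‖ ≤ ‖y - x‖ := by rw [norm_sub_rev]; exact norm_sub_norm_le x y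
  have hx0 := norm_nonneg x
  have hy0 := norm_nonneg y
  have hy1 : ‖y‖ < 1 := by nlinarith
  refine ⟨by simpa [hypSpace] using hy1, ?_, ?_⟩ <;> nlinarith

/-- A nearly minimal curve from `p` to `x` is prolonged by the straight segment to `y`. On that
segment the conformal factor is comparable to the one at `x`, so the added length is at most 1. -/
lemma mem_hypBall_of_norm_sub_le {p x y : Coord m} {r : ℝ} (hp : p ∈ hypSpace m)
    (hx : x ∈ hypBall m p (r - 1)) (hy : ‖y - x‖ ≤ (1 - ‖x‖ ^ 2) / 8) : y ∈ hypBall m p r := by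
  obtain ⟨hxS, hxd⟩ := hx
  have hA := one_sub_norm_sq_pos hxS
  have hseg : ∀ s ∈ Icc (0 : ℝ) 1, ‖(x + s • (y - x)) - x‖ ≤ (1 - ‖x‖ ^ 2) / 8 := by
    intro s hs
    rw [add_sub_cancel_left, norm_smul, Real.norm_of_nonneg hs.1]
    nlinarith [norm_nonneg (y - x), hs.2]
  refine ⟨(one_sub_norm_sq_comparable hxS hy).1, ?_⟩
  -- Needed because a real infimum over the empty set is `0`, which would say nothing about curves.
  have hne : {L : ℝ | ∃ (γ : ℝ → Coord m) (a b : ℝ),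
      IsPiecewiseC1Curve (hypSpace m) p x γ a b ∧
        L = ∫ s in a..b, speed (hypMetric m) γ s}.Nonempty := by
    refine ⟨_, _, _, _, isPiecewiseC1Curve_segment fun s hs => ?_, rfl⟩
    exact (convex_ball (0 : Coord m) 1).add_smul_sub_mem hp hxS hs
  obtain ⟨_, ⟨γ, a, b, hγ, rfl⟩, hL⟩ := exists_lt_of_csInf_lt hne hxd
  have hnew := hγ.appendSegment fun s hs => (one_sub_norm_sq_comparable hxS (hseg s hs)).1
  have hint := hnew.intervalIntegrable_speed
  have hab := hγ.2.2.1
  have hb : b ∈ uIcc a (b + 1) := by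
    rw [uIcc_of_le (by linarith)]; exact ⟨hab, by linarith⟩
  have hsplit := intervalIntegral.integral_add_adjacent_intervals
    (hint.mono_set (uIcc_subset_uIcc left_mem_uIcc hb))
    (hint.mono_set (uIcc_subset_uIcc hb right_mem_uIcc))
  have hfirst : ∫ s in a..b, speed (hypMetric m) (appendSegment γ b x y) s
      = ∫ s in a..b, speed (hypMetric m) γ s := by
    rw [intervalIntegral.integral_of_le hab, intervalIntegral.integral_of_le hab,
      integral_Ioc_eq_integral_Ioo, integral_Ioc_eq_integral_Ioo]
    exact setIntegral_congr_fun measurableSet_Ioo fun s hs =>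
      speed_appendSegment_of_lt _ _ _ _ _ hs.2
  have hsecond : ‖∫ s in b..(b + 1), speed (hypMetric m) (appendSegment γ b x y) s‖
      ≤ 1 * |b + 1 - b| := by
    refine intervalIntegral.norm_integral_le_of_norm_le_const fun s hs => ?_
    rw [uIoc_of_le (by linarith)] at hs
    have hB := one_sub_norm_sq_comparable hxS (hseg (s - b) ⟨by linarith [hs.1], by linarith [hs.2]⟩)
    rw [Real.norm_of_nonneg (speed_nonneg _ _ _), speed_appendSegment_of_gt _ _ _ _ hs.1,
      Real.sqrt_le_iff]
    refine ⟨zero_le_one, ?_⟩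
    rw [one_pow, div_mul_eq_mul_div, div_le_one (pow_pos (by linarith [hB.2.1]) 2)]
    -- With `A = 1 - ‖x‖²`, the left side is at most `A/4` and the right side at least `3A/4`.
    have h1 : 2 * ‖y - x‖ ≤ 1 - ‖x + (s - b) • (y - x)‖ ^ 2 := by linarith [hB.2.1]
    nlinarith [norm_nonneg (y - x)]
  have hle := csInf_le (riemDist_lengths_bddBelow (hypSpace m) (hypMetric m) p y)
    ⟨_, _, _, hnew, rfl⟩
  rw [add_sub_cancel_left, abs_one, mul_one] at hsecond
  have h2 := (le_abs_self _).trans hsecond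
  change riemDist _ _ _ _ ≤ _ at hle
  linarith

end YamabeHyp

/-! ### Scalar curvature of conformally flat metrics -/

namespace YamabeHyp

open Set

variable {m : ℕ}

lemma pd_congr {k : Fin m} {f₁ f₂ : Coord m → ℝ} {x : Coord m} (h : f₁ =ᶠ[nhds x] f₂) :
    pd k f₁ x = pd k f₂ x := by
  rw [pd, pd, h.fderiv_eq]

lemma pd_log {k : Fin m} {f : Coord m → ℝ} {x : Coord m} (hf : DifferentiableAt ℝ f x)
    (h0 : f x ≠ 0) : pd k (fun y => Real.log (f y)) x = pd k f x / f x := by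
  rw [pd, (hf.hasFDerivAt.log h0).fderiv, pd]
  simp [div_eq_inv_mul]

lemma pd_const_mul {k : Fin m} (c : ℝ) {f : Coord m → ℝ} {x : Coord m} (hf : DifferentiableAt ℝ f x) :
    pd k (fun y => c * f y) x = c * pd k f x := by
  rw [pd, (hf.hasFDerivAt.const_mul c).fderiv, pd]
  simp

lemma pd_add {k : Fin m} {f₁ f₂ : Coord m → ℝ} {x : Coord m} (h₁ : DifferentiableAt ℝ f₁ x)
    (h₂ : DifferentiableAt ℝ f₂ x) :
    pd k (fun y => f₁ y + f₂ y) x = pd k f₁ x + pd k f₂ x := by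
  rw [pd, (h₁.hasFDerivAt.fun_add h₂.hasFDerivAt).fderiv, pd, pd]
  simp

lemma pd_sub {k : Fin m} {f₁ f₂ : Coord m → ℝ} {x : Coord m} (h₁ : DifferentiableAt ℝ f₁ x)
    (h₂ : DifferentiableAt ℝ f₂ x) :
    pd k (fun y => f₁ y - f₂ y) x = pd k f₁ x - pd k f₂ x := by
  rw [pd, (h₁.hasFDerivAt.fun_sub h₂.hasFDerivAt).fderiv, pd, pd]
  simp

/-- Christoffel symbols of the conformally flat metric `e^L δ`, `f = ∇L`. -/
noncomputable def conformalChristoffel (f : Fin m → ℝ) (k i j : Fin m) : ℝ :=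
  (1 / 2 : ℝ) * ((if j = k then 1 else 0) * f i + (if i = k then 1 else 0) * f j
    - (if i = j then 1 else 0) * f k)

lemma christoffel_conformal {g : MetricField m} {Ω : Set (Coord m)} (hΩ : IsOpen Ω)
    {v : Coord m → ℝ} (hg : ∀ y ∈ Ω, g y = v y • (1 : Matrix (Fin m) (Fin m) ℝ))
    (hv : ∀ y ∈ Ω, 0 < v y) (hd : DifferentiableOn ℝ v Ω) {x : Coord m} (hx : x ∈ Ω)
    (k i j : Fin m) :
    christoffel g k i j x
      = conformalChristoffel (fun i => pd i (fun y => Real.log (v y)) x) k i j := by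
  have hdx : DifferentiableAt ℝ v x := hd.differentiableAt (hΩ.mem_nhds hx)
  have hne := (hv x hx).ne'
  have hpd : ∀ a b c : Fin m, pd a (fun y => g y b c) x
      = (if b = c then 1 else 0) * pd a v x := by
    intro a b c
    rw [← pd_const_mul _ hdx]
    refine pd_congr ?_
    filter_upwards [hΩ.mem_nhds hx] with y hy
    rw [hg y hy, Matrix.smul_apply, Matrix.one_apply, smul_eq_mul, mul_comm]
  have hinv : (g x)⁻¹ = (v x)⁻¹ • (1 : Matrix (Fin m) (Fin m) ℝ) := by
    rw [hg x hx]
    refine Matrix.inv_eq_left_inv ?_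
    rw [smul_mul_smul_comm, one_mul, inv_mul_cancel₀ hne, one_smul]
  simp only [christoffel, hinv, hpd, conformalChristoffel, pd_log hdx hne, Matrix.smul_apply,
    Matrix.one_apply, smul_eq_mul, mul_ite, mul_one, mul_zero, ite_mul, zero_mul,
    Finset.sum_ite_eq, Finset.mem_univ, if_true]
  split_ifs <;> field_simp <;> ring

lemma sum_conformalChristoffel_diag (f : Fin m → ℝ) (k : Fin m) :
    ∑ j, conformalChristoffel f k j j = (1 - m / 2) * f k := by
  simp only [conformalChristoffel, if_true, ← Finset.mul_sum, Finset.sum_add_distrib,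
    Finset.sum_sub_distrib, ite_mul, one_mul, zero_mul, Finset.sum_ite_eq', Finset.mem_univ,
    Finset.sum_const, Finset.card_univ, Fintype.card_fin, nsmul_eq_mul]
  ring

lemma conformalChristoffel_contract (f : Fin m → ℝ) (k j : Fin m) :
    conformalChristoffel f k k j = f j / 2 := by
  simp only [conformalChristoffel, if_true]
  rcases eq_or_ne j k with rfl | h
  · simp; ring
  · simp [h, h.symm]; ring

lemma sum_conformalChristoffel_mul (f : Fin m → ℝ) :
    ∑ j, ∑ k, ∑ p, conformalChristoffel f k j p * conformalChristoffel f p k j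
      = (2 - m) / 4 * ∑ i, f i ^ 2 := by
  -- The two factors are `(a + (b - c))/2` and `(a - (b - c))/2`, so the product is `(a² - b² - c² +
  -- 2bc)/4`, and `bc` survives only for `j = k = p`.
  have key : ∀ j k p : Fin m, conformalChristoffel f k j p * conformalChristoffel f p k j
      = 1 / 4 * ((if p = k then f j ^ 2 else 0) - (if j = k then f p ^ 2 else 0)
        - (if j = p then f k ^ 2 else 0)
        + 2 * (if j = k then (if j = p then f j ^ 2 else 0) else 0)) := by
    intro j k p
    simp only [conformalChristoffel]
    by_cases h1 : p = k <;> by_cases h2 : j = k <;> by_cases h3 : j = p <;>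
      simp_all [eq_comm] <;> ring
  simp only [key, ← Finset.mul_sum, Finset.sum_add_distrib, Finset.sum_sub_distrib]
  have e1 : ∑ j : Fin m, ∑ k : Fin m, ∑ p : Fin m, (if p = k then f j ^ 2 else 0)
      = m * ∑ i, f i ^ 2 := by
    simp [Finset.mul_sum]
  have e2 : ∑ j : Fin m, ∑ k : Fin m, ∑ p : Fin m, (if j = k then f p ^ 2 else 0)
      = m * ∑ i, f i ^ 2 := by
    have : ∀ j k : Fin m, ∑ p : Fin m, (if j = k then f p ^ 2 else 0)
        = if j = k then ∑ p, f p ^ 2 else 0 := by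
      intro j k; split_ifs <;> simp
    simp [this]
  have e3 : ∑ j : Fin m, ∑ k : Fin m, ∑ p : Fin m, (if j = p then f k ^ 2 else 0)
      = m * ∑ i, f i ^ 2 := by
    simp
  have e4 : ∑ j : Fin m, ∑ k : Fin m, ∑ p : Fin m,
      (if j = k then (if j = p then f j ^ 2 else 0) else 0) = ∑ i, f i ^ 2 := by
    have : ∀ j k : Fin m, ∑ p : Fin m, (if j = k then (if j = p then f j ^ 2 else 0) else 0)
        = if j = k then f j ^ 2 else 0 := by
      intro j k; split_ifs <;> simp
    simp [this]
  rw [e1, e2, e3, e4]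
  ring

lemma pd_conformalChristoffel {F : Fin m → Coord m → ℝ} {x : Coord m}
    (hF : ∀ i, DifferentiableAt ℝ (F i) x) (a k i j : Fin m) :
    pd a (fun y => conformalChristoffel (fun i => F i y) k i j) x
      = conformalChristoffel (fun i => pd a (F i) x) k i j := by
  have h : ∀ (c : ℝ) i, DifferentiableAt ℝ (fun y => c * F i y) x := fun c i =>
    (hF i).const_mul c
  simp only [conformalChristoffel]
  rw [pd_const_mul _ (((h _ _).fun_add (h _ _)).fun_sub (h _ _)), pd_sub ((h _ _).fun_add (h _ _)) (h _ _),
    pd_add (h _ _) (h _ _), pd_const_mul _ (hF _), pd_const_mul _ (hF _), pd_const_mul _ (hF _)]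

/-- The scalar curvature of the conformally flat metric `v δ`, in terms of `log v`. -/
theorem scalarCurvature_conformal {g : MetricField m} {Ω : Set (Coord m)} (hΩ : IsOpen Ω)
    {v : Coord m → ℝ} (hg : ∀ y ∈ Ω, g y = v y • (1 : Matrix (Fin m) (Fin m) ℝ))
    (hv : ∀ y ∈ Ω, 0 < v y) (hd : DifferentiableOn ℝ v Ω)
    (hd2 : ∀ i, ∀ y ∈ Ω, DifferentiableAt ℝ (pd i (fun y => Real.log (v y))) y)
    {x : Coord m} (hx : x ∈ Ω) :
    -scalarCurvature g x * v x = (m - 1) * (∑ i, pd i (pd i (fun y => Real.log (v y))) x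
      + (m - 2) / 4 * ∑ i, pd i (fun y => Real.log (v y)) x ^ 2) := by
  have hne := (hv x hx).ne'
  have hinv : (g x)⁻¹ = (v x)⁻¹ • (1 : Matrix (Fin m) (Fin m) ℝ) := by
    rw [hg x hx]
    refine Matrix.inv_eq_left_inv ?_
    rw [smul_mul_smul_comm, one_mul, inv_mul_cancel₀ hne, one_smul]
  set F : Fin m → Coord m → ℝ := fun i => pd i (fun y => Real.log (v y)) with hF
  have hΓ : ∀ k i j, ∀ y ∈ Ω, christoffel g k i j y = conformalChristoffel (fun i => F i y) k i j :=
    fun k i j y hy => christoffel_conformal hΩ hg hv hd hy k i j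
  have hpdΓ : ∀ a k i j, pd a (christoffel g k i j) x
      = conformalChristoffel (fun i => pd a (F i) x) k i j := by
    intro a k i j
    rw [← pd_conformalChristoffel (fun i => hd2 i x hx)]
    refine pd_congr ?_
    filter_upwards [hΩ.mem_nhds hx] with y hy using hΓ k i j y hy
  have hR : scalarCurvature g x = (v x)⁻¹ * ∑ j, ∑ k, riemann g k j k j x := by
    simp only [scalarCurvature, hinv, ricci, Matrix.smul_apply, Matrix.one_apply, smul_eq_mul,
      mul_ite, mul_one, mul_zero, ite_mul, zero_mul, Finset.sum_ite_eq, Finset.mem_univ, if_true]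
    rw [Finset.mul_sum]
  have hsum : ∑ j, ∑ k, riemann g k j k j x
      = -((m - 1) * (∑ i, pd i (F i) x + (m - 2) / 4 * ∑ i, F i x ^ 2)) := by
    -- The coefficient of the Laplacian is `(1 - m/2) - m/2`; that of the squared gradient is
    -- `(m/2)(1 - m/2) - (2 - m)/4 = -(m-1)(m-2)/4`.
    simp only [riemann, hpdΓ, hΓ _ _ _ x hx, Finset.sum_add_distrib, Finset.sum_sub_distrib,
      sum_conformalChristoffel_mul, conformalChristoffel_contract]
    have e1 : ∑ j, ∑ k, conformalChristoffel (fun i => pd k (F i) x) k j j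
        = (1 - m / 2) * ∑ i, pd i (F i) x := by
      rw [Finset.sum_comm, Finset.mul_sum]
      exact Finset.sum_congr rfl fun k _ => sum_conformalChristoffel_diag _ k
    have e2 : ∑ j : Fin m, ∑ _k : Fin m, pd j (F j) x / 2 = m / 2 * ∑ i, pd i (F i) x := by
      simp only [Finset.sum_const, Finset.card_univ, Fintype.card_fin, nsmul_eq_mul,
        Finset.mul_sum]
      exact Finset.sum_congr rfl fun k _ => by ring
    have e3 : ∑ j, ∑ _k : Fin m, ∑ p, F p x / 2 * conformalChristoffel (fun i => F i x) p j j
        = m / 2 * (1 - m / 2) * ∑ i, F i x ^ 2 := by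
      simp only [Finset.sum_const, Finset.card_univ, Fintype.card_fin, nsmul_eq_mul]
      rw [← Finset.mul_sum, Finset.sum_comm]
      simp only [← Finset.mul_sum, sum_conformalChristoffel_diag]
      simp only [Finset.mul_sum]
      exact Finset.sum_congr rfl fun k _ => by ring
    rw [e1, e2, e3]
    ring
  rw [hR, hsum, neg_mul, mul_right_comm, inv_mul_cancel₀ hne, one_mul, neg_neg]

end YamabeHyp

/-! ### Derivatives of logarithms of quadratics -/

namespace YamabeHyp

open Set Filter Topology

variable {m : ℕ}

lemma pd_div {k : Fin m} {f₁ f₂ : Coord m → ℝ} {x : Coord m} (h₁ : DifferentiableAt ℝ f₁ x)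
    (h₂ : DifferentiableAt ℝ f₂ x) (h0 : f₂ x ≠ 0) :
    pd k (fun y => f₁ y / f₂ y) x = (pd k f₁ x * f₂ x - f₁ x * pd k f₂ x) / f₂ x ^ 2 := by
  have hinv : HasFDerivAt (fun y => (f₂ y)⁻¹) (-(f₂ x ^ 2)⁻¹ • fderiv ℝ f₂ x) x :=
    (hasDerivAt_inv h0).comp_hasFDerivAt x h₂.hasFDerivAt
  simp only [div_eq_mul_inv]
  rw [pd, (h₁.hasFDerivAt.fun_mul hinv).fderiv, pd, pd]
  simp
  field_simp
  ring

lemma pd_coord_sub (k : Fin m) (c y : Coord m) : pd k (fun y : Coord m => y k - c k) y = 1 := by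
  have h : HasFDerivAt (fun y : Coord m => y k - c k) (EuclideanSpace.proj k : Coord m →L[ℝ] ℝ) y :=
    (EuclideanSpace.proj k : Coord m →L[ℝ] ℝ).hasFDerivAt.sub_const _
  rw [pd, h.fderiv]
  simp

lemma pd_norm_sub_sq (k : Fin m) (c y : Coord m) :
    pd k (fun y : Coord m => ‖y - c‖ ^ 2) y = 2 * (y k - c k) := by
  have h := ((hasFDerivAt_id y).sub_const c).norm_sq
  rw [pd]
  erw [h.fderiv]
  simp [EuclideanSpace.inner_single_right]

lemma pd_one_sub_mul_norm_sub_sq (k : Fin m) (κ : ℝ) (c y : Coord m) :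
    pd k (fun y : Coord m => 1 - κ * ‖y - c‖ ^ 2) y = -(2 * κ * (y k - c k)) := by
  have hd : DifferentiableAt ℝ (fun y : Coord m => ‖y - c‖ ^ 2) y :=
    (differentiableAt_id.sub_const c).norm_sq ℝ
  rw [pd_sub (differentiableAt_const 1) (hd.const_mul κ), pd_const_mul _ hd, pd_norm_sub_sq]
  simp [pd]
  ring

lemma contDiff_one_sub_mul_norm_sub_sq (κ : ℝ) (c : Coord m) {n : WithTop ℕ∞} :
    ContDiff ℝ n fun y : Coord m => 1 - κ * ‖y - c‖ ^ 2 :=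
  contDiff_const.sub (contDiff_const.mul ((contDiff_id.sub contDiff_const).norm_sq ℝ))

lemma pd_log_quadratic (k : Fin m) (κ : ℝ) (c y : Coord m) (h0 : 1 - κ * ‖y - c‖ ^ 2 ≠ 0) :
    pd k (fun y => Real.log (1 - κ * ‖y - c‖ ^ 2)) y
      = -(2 * κ) * ((y k - c k) / (1 - κ * ‖y - c‖ ^ 2)) := by
  rw [pd_log ((contDiff_one_sub_mul_norm_sub_sq κ c (n := 1)).differentiable one_ne_zero _) h0,
    pd_one_sub_mul_norm_sub_sq]
  ring

lemma pd_pd_log_quadratic (k : Fin m) (κ : ℝ) (c y : Coord m) (h0 : 1 - κ * ‖y - c‖ ^ 2 ≠ 0) :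
    pd k (pd k (fun y => Real.log (1 - κ * ‖y - c‖ ^ 2))) y
      = -(2 * κ) / (1 - κ * ‖y - c‖ ^ 2)
        - 4 * κ ^ 2 * (y k - c k) ^ 2 / (1 - κ * ‖y - c‖ ^ 2) ^ 2 := by
  have hQ := contDiff_one_sub_mul_norm_sub_sq κ c (n := 1)
  have hQd := hQ.differentiable one_ne_zero y
  have hev : pd k (fun y => Real.log (1 - κ * ‖y - c‖ ^ 2))
      =ᶠ[𝓝 y] fun y => -(2 * κ) * ((y k - c k) / (1 - κ * ‖y - c‖ ^ 2)) := by
    filter_upwards [hQ.continuous.continuousAt.eventually_ne h0] with z hz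
    exact pd_log_quadratic k κ c z hz
  have hc : DifferentiableAt ℝ (fun y : Coord m => y k - c k) y := by fun_prop
  have hq : DifferentiableAt ℝ (fun y : Coord m => (y k - c k) / (1 - κ * ‖y - c‖ ^ 2)) y :=
    by simpa only [div_eq_mul_inv] using hc.fun_mul (hQd.fun_inv (by exact h0))
  rw [pd_congr hev, pd_const_mul _ hq, pd_div hc hQd h0,
    pd_coord_sub, pd_one_sub_mul_norm_sub_sq]
  field_simp
  ring

lemma contDiffAt_log_quadratic (κ : ℝ) (c y : Coord m) (h0 : 1 - κ * ‖y - c‖ ^ 2 ≠ 0)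
    {n : WithTop ℕ∞} : ContDiffAt ℝ n (fun y => Real.log (1 - κ * ‖y - c‖ ^ 2)) y :=
  (contDiff_one_sub_mul_norm_sub_sq κ c).contDiffAt.log h0

lemma ContDiffAt.differentiableAt_pd {f : Coord m → ℝ} {y : Coord m} (hf : ContDiffAt ℝ 2 f y)
    (k : Fin m) : DifferentiableAt ℝ (pd k f) y := by
  have h : ContDiffAt ℝ 1 (fderiv ℝ f) y := hf.fderiv_right (by norm_num)
  exact (h.differentiableAt one_ne_zero).clm_apply (differentiableAt_const _)

lemma ContDiffAt.eventually_differentiableAt {f : Coord m → ℝ} {y : Coord m}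
    (hf : ContDiffAt ℝ 2 f y) : ∀ᶠ z in 𝓝 y, DifferentiableAt ℝ f z := by
  filter_upwards [hf.eventually (by simp)] with z hz
  exact hz.differentiableAt two_ne_zero

/-! ### Second-order conditions at a local minimum -/

/-- Were it negative, the second derivative test would make `a` a local maximum too, so `f` would be
locally constant and the second derivative zero. -/
lemma deriv_deriv_nonneg_of_isLocalMin {f : ℝ → ℝ} {a : ℝ} (h : IsLocalMin f a)
    (hc : ContinuousAt f a) : 0 ≤ deriv (deriv f) a := by
  by_contra! hneg
  have hmax := isLocalMax_of_deriv_deriv_neg hneg h.deriv_eq_zero hc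
  have he : f =ᶠ[𝓝 a] fun _ => f a := by
    filter_upwards [h, hmax] with z h1 h2 using le_antisymm h2 h1
  have he' : deriv f =ᶠ[𝓝 a] fun _ => 0 := by
    filter_upwards [he.eventuallyEq_nhds] with z hz
    rw [hz.deriv_eq, deriv_const]
  rw [he'.deriv_eq, deriv_const] at hneg
  exact lt_irrefl _ hneg

lemma pd_pd_nonneg_of_isLocalMin {G : Coord m → ℝ} {y : Coord m} (h : IsLocalMin G y)
    (hG : ContDiffAt ℝ 2 G y) (k : Fin m) : 0 ≤ pd k (pd k G) y := by
  set e : Coord m := EuclideanSpace.single k 1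
  have hline : ∀ s : ℝ, HasDerivAt (fun s : ℝ => y + s • e) e s := fun s => by
    simpa using ((hasDerivAt_id s).smul_const e).const_add y
  have hcont : ContinuousAt (fun s : ℝ => y + s • e) 0 := (hline 0).continuousAt
  have hy0 : y + (0 : ℝ) • e = y := by simp
  have htend : Tendsto (fun s : ℝ => y + s • e) (𝓝 0) (𝓝 y) := by
    simpa only [ContinuousAt, hy0] using hcont
  have hder : ∀ f : Coord m → ℝ, ∀ s : ℝ, DifferentiableAt ℝ f (y + s • e) →
      deriv (fun s : ℝ => f (y + s • e)) s = pd k f (y + s • e) := fun f s hf =>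
    (hf.hasFDerivAt.comp_hasDerivAt s (hline s)).deriv
  have hmin : IsLocalMin (fun s : ℝ => G (y + s • e)) 0 := by
    have := htend.eventually h
    filter_upwards [this] with s hs
    simpa only [hy0] using hs
  have hc : ContinuousAt (fun s : ℝ => G (y + s • e)) 0 := by
    refine ContinuousAt.comp (g := G) ?_ hcont
    rw [hy0]; exact hG.continuousAt
  have h2 := deriv_deriv_nonneg_of_isLocalMin hmin hc
  have he : deriv (fun s : ℝ => G (y + s • e)) =ᶠ[𝓝 0] fun s => pd k G (y + s • e) := by
    filter_upwards [htend.eventually (ContDiffAt.eventually_differentiableAt hG)] with s hs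
    exact hder G s hs
  rw [he.deriv_eq, hder (pd k G) 0 (by rw [hy0]; exact ContDiffAt.differentiableAt_pd hG k), hy0] at h2
  exact h2

lemma pd_eq_zero_of_isLocalMin {G : Coord m → ℝ} {y : Coord m} (h : IsLocalMin G y)
    (k : Fin m) : pd k G y = 0 := by
  rw [pd, h.fderiv_eq_zero]; rfl

/-- Comparison of gradients and second derivatives of two functions whose difference has a local
minimum. -/
lemma pd_comparison_of_isLocalMin {f P : Coord m → ℝ} {y : Coord m} (hf : ContDiffAt ℝ 2 f y)
    (hP : ContDiffAt ℝ 2 P y) (h : IsLocalMin (fun z => f z - P z) y) (k : Fin m) :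
    pd k f y = pd k P y ∧ pd k (pd k P) y ≤ pd k (pd k f) y := by
  have hfd := ContDiffAt.eventually_differentiableAt hf
  have hPd := ContDiffAt.eventually_differentiableAt hP
  have h1 := pd_eq_zero_of_isLocalMin h k
  have h2 := pd_pd_nonneg_of_isLocalMin h (hf.sub hP) k
  rw [pd_sub hfd.self_of_nhds hPd.self_of_nhds] at h1
  have he : pd k (fun z => f z - P z) =ᶠ[𝓝 y] fun z => pd k f z - pd k P z := by
    filter_upwards [hfd, hPd] with z hz1 hz2 using pd_sub hz1 hz2
  rw [pd_congr he, pd_sub (ContDiffAt.differentiableAt_pd hf k)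
    (ContDiffAt.differentiableAt_pd hP k)] at h2
  exact ⟨sub_eq_zero.1 h1, sub_nonneg.1 h2⟩

/-! ### The barrier and its differential inequality -/

/-- Up to an additive constant, the logarithm of the spatial profile
`(1 - κ |y - x|²)^16 · 4 (1 - |y|²)⁻²` of the barrier. -/
noncomputable def barrierLog (κ : ℝ) (x y : Coord m) : ℝ :=
  16 * Real.log (1 - κ * ‖y - x‖ ^ 2) - 2 * Real.log (1 - 1 * ‖y - 0‖ ^ 2)

section Barrier

variable {κ : ℝ} {x y : Coord m}

lemma contDiffAt_barrierLog (h1 : 0 < 1 - κ * ‖y - x‖ ^ 2) (h2 : 0 < 1 - ‖y‖ ^ 2)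
    {n : WithTop ℕ∞} : ContDiffAt ℝ n (barrierLog κ x) y := by
  refine ContDiffAt.sub (contDiffAt_const.mul (contDiffAt_log_quadratic κ x y h1.ne'))
    (contDiffAt_const.mul (contDiffAt_log_quadratic 1 0 y ?_))
  simpa using h2.ne'

lemma pd_barrierLog (h1 : 0 < 1 - κ * ‖y - x‖ ^ 2) (h2 : 0 < 1 - ‖y‖ ^ 2) (k : Fin m) :
    pd k (barrierLog κ x) y = 16 * pd k (fun y => Real.log (1 - κ * ‖y - x‖ ^ 2)) y
      - 2 * pd k (fun y => Real.log (1 - 1 * ‖y - 0‖ ^ 2)) y := by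
  have d1 := (contDiffAt_log_quadratic κ x y h1.ne' (n := 1)).differentiableAt one_ne_zero
  have d2 := (contDiffAt_log_quadratic 1 0 y (by simpa using h2.ne') (n := 1)).differentiableAt
    one_ne_zero
  unfold barrierLog
  rw [pd_sub (d1.const_mul _) (d2.const_mul _), pd_const_mul _ d1, pd_const_mul _ d2]

lemma pd_pd_barrierLog (h1 : 0 < 1 - κ * ‖y - x‖ ^ 2) (h2 : 0 < 1 - ‖y‖ ^ 2) (k : Fin m) :
    pd k (pd k (barrierLog κ x)) y
      = 16 * pd k (pd k (fun y => Real.log (1 - κ * ‖y - x‖ ^ 2))) y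
        - 2 * pd k (pd k (fun y => Real.log (1 - 1 * ‖y - 0‖ ^ 2))) y := by
  have d1 := ContDiffAt.differentiableAt_pd (contDiffAt_log_quadratic κ x y h1.ne') k
  have d2 := ContDiffAt.differentiableAt_pd
    (contDiffAt_log_quadratic 1 0 y (by simpa using h2.ne')) k
  have he : pd k (barrierLog κ x) =ᶠ[𝓝 y] fun y =>
      16 * pd k (fun y => Real.log (1 - κ * ‖y - x‖ ^ 2)) y
      - 2 * pd k (fun y => Real.log (1 - 1 * ‖y - 0‖ ^ 2)) y := by
    have c1 : Continuous fun y : Coord m => 1 - κ * ‖y - x‖ ^ 2 := by fun_prop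
    have c2 : Continuous fun y : Coord m => 1 - ‖y‖ ^ 2 := by fun_prop
    filter_upwards [c1.continuousAt.eventually (lt_mem_nhds h1),
      c2.continuousAt.eventually (lt_mem_nhds h2)] with z hz1 hz2 using pd_barrierLog hz1 hz2 k
  rw [pd_congr he, pd_sub (d1.const_mul _) (d2.const_mul _), pd_const_mul _ d1, pd_const_mul _ d2]

/-- The exponent 16 is large enough that the squared gradient, already with its weight `1/4` for `m
= 3`, absorbs the negative Hessian of `log η` and the cross term with the hyperbolic factor, leaving
a positive multiple of `|∇ log η|²`. -/
lemma barrierLog_operator_ge (hm : 3 ≤ m) (h1 : 0 < 1 - κ * ‖y - x‖ ^ 2) (h2 : 0 < 1 - ‖y‖ ^ 2) :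
    32 * κ / (1 - κ * ‖y - x‖ ^ 2) ^ 2 * (2 - (m + 2) * (1 - κ * ‖y - x‖ ^ 2))
      ≤ ∑ k, pd k (pd k (barrierLog κ x)) y
        + ((m : ℝ) - 2) / 4 * ∑ k, pd k (barrierLog κ x) y ^ 2 := by
  set η := 1 - κ * ‖y - x‖ ^ 2 with hη
  -- The hyperbolic factor is the case `κ = 1`, centre `0` of the same quadratic, so one set of
  -- derivative formulas serves both.
  have h2' : 1 - 1 * ‖y - 0‖ ^ 2 = 1 - ‖y‖ ^ 2 := by simp
  have hm' : (3 : ℝ) ≤ m := by exact_mod_cast hm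
  have hterm : ∀ k : Fin m, -(32 * κ) / η + 64 * κ ^ 2 / η ^ 2 * (y k - x k) ^ 2
      ≤ pd k (pd k (barrierLog κ x)) y + ((m : ℝ) - 2) / 4 * pd k (barrierLog κ x) y ^ 2 := by
    intro k
    rw [pd_pd_barrierLog h1 h2, pd_barrierLog h1 h2, pd_pd_log_quadratic _ _ _ _ h1.ne',
      pd_log_quadratic _ _ _ _ h1.ne', pd_pd_log_quadratic _ _ _ _ (by rw [h2']; exact h2.ne'),
      pd_log_quadratic _ _ _ _ (by rw [h2']; exact h2.ne'), h2', ← hη]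
    set B := 1 - ‖y‖ ^ 2
    simp only [PiLp.zero_apply, sub_zero]
    have e1 : 4 * κ ^ 2 * (y k - x k) ^ 2 / η ^ 2 = 4 * (κ * ((y k - x k) / η)) ^ 2 := by
      field_simp
    have e2 : 4 * (1 : ℝ) ^ 2 * y k ^ 2 / B ^ 2 = 4 * (y k / B) ^ 2 := by
      field_simp
    have e3 : 64 * κ ^ 2 / η ^ 2 * (y k - x k) ^ 2 = 64 * (κ * ((y k - x k) / η)) ^ 2 := by
      field_simp
    have e4 : -(32 * κ) / η = 16 * (-(2 * κ) / η) := by ring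
    rw [e1, e2, e3, e4]
    have e5 : 16 * (-(2 * κ) * ((y k - x k) / η)) - 2 * (-(2 * 1) * (y k / B))
      = 4 * (y k / B) - 32 * (κ * ((y k - x k) / η)) := by ring
    rw [e5]
    generalize κ * ((y k - x k) / η) = a
    generalize y k / B = b
    have hB : 0 ≤ (1 : ℝ) / B := by positivity
    have e6 : -(2 * (1 : ℝ)) / B = -2 * (1 / B) := by ring
    rw [e6]
    have hsq : (1 : ℝ) / 4 * (4 * b - 32 * a) ^ 2 ≤ ((m : ℝ) - 2) / 4 * (4 * b - 32 * a) ^ 2 :=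
      mul_le_mul_of_nonneg_right (by linarith) (sq_nonneg _)
    -- After the term in `1/B` is dropped, what remains is `12b² - 64ab + 128a² = (4b - 16a)²/2 +
    -- 4b²`.
    nlinarith [sq_nonneg (4 * b - 16 * a), sq_nonneg b]
  calc _ = ∑ k : Fin m, (-(32 * κ) / η + 64 * κ ^ 2 / η ^ 2 * (y k - x k) ^ 2) := by
        have hn : ∑ k : Fin m, (y k - x k) ^ 2 = ‖y - x‖ ^ 2 := by
          rw [EuclideanSpace.real_norm_sq_eq]; rfl
        rw [Finset.sum_add_distrib, ← Finset.mul_sum, hn]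
        simp only [Finset.sum_const, Finset.card_univ, Fintype.card_fin, nsmul_eq_mul]
        have : κ * ‖y - x‖ ^ 2 = 1 - η := by rw [hη]; ring
        have e : 64 * κ ^ 2 / η ^ 2 * ‖y - x‖ ^ 2 = 64 * κ / η ^ 2 * (1 - η) := by
          rw [← this]; ring
        rw [e]
        field_simp
        ring
    _ ≤ _ := by
        rw [Finset.mul_sum, ← Finset.sum_add_distrib]
        exact Finset.sum_le_sum fun k _ => hterm k

end Barrier

/-- For `Mη ≤ 2` the two sides have opposite signs. Otherwise `(Mη)^16 ≥ 1` turns `M²` into at most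
`M^18 η^16`, which fixes the power 18; the factor `2048` is `32 · 64`. -/
lemma barrier_scalar_inequality {M A B η : ℝ} (hM : 2 ≤ M) (hA : 0 < A) (hB : 0 < B)
    (hBA : B ≤ 5 / 4 * A) (hη : 0 < η) :
    -(2048 * M ^ 18 * (η ^ 16 * (4 / B ^ 2))) < 32 * (64 / A ^ 2) / η ^ 2 * (2 - M * η) := by
  by_cases h : M * η ≤ 2
  · have h1 : 0 ≤ 32 * (64 / A ^ 2) / η ^ 2 * (2 - M * η) :=
      mul_nonneg (by positivity) (by linarith)
    have h2 : 0 < 2048 * M ^ 18 * (η ^ 16 * (4 / B ^ 2)) := by positivity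
    linarith
  · push Not at h
    have hMη : 1 ≤ (M * η) ^ 16 := one_le_pow₀ (by linarith)
    have h4 : 1 / A ^ 2 ≤ 4 / B ^ 2 := by
      rw [div_le_div_iff₀ (by positivity) (by positivity)]
      nlinarith
    have hl : 2048 * M ^ 2 * (1 / A ^ 2) ≤ 2048 * M ^ 18 * (η ^ 16 * (4 / B ^ 2)) := by
      calc 2048 * M ^ 2 * (1 / A ^ 2) ≤ 2048 * M ^ 2 * (4 / B ^ 2) := by gcongr
        _ = 2048 * M ^ 2 * (1 * (4 / B ^ 2)) := by ring
        _ ≤ 2048 * M ^ 2 * ((M * η) ^ 16 * (4 / B ^ 2)) := by gcongr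
        _ = _ := by ring
    have hr : M * η / η ^ 2 - 2 / η ^ 2 < M ^ 2 := by
      rw [← sub_div, div_lt_iff₀ (by positivity)]
      nlinarith
    have e : 32 * (64 / A ^ 2) / η ^ 2 * (2 - M * η)
        = -(2048 * (M * η / η ^ 2 - 2 / η ^ 2) * (1 / A ^ 2)) := by ring
    rw [e]
    have : 2048 * (M * η / η ^ 2 - 2 / η ^ 2) * (1 / A ^ 2) < 2048 * M ^ 2 * (1 / A ^ 2) := by
      gcongr
    linarith

/-! ### First contact and parabolic comparison -/

/-- A continuous function on `K × [0, t₁]`, positive initially and not positive throughout, has a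
first zero. -/
lemma exists_first_zero {X : Type*} [TopologicalSpace X] [T2Space X] {K : Set X} (hK : IsCompact K)
    {t₁ : ℝ} {f : X × ℝ → ℝ} (hf : ContinuousOn f (K ×ˢ Icc 0 t₁))
    (h0 : ∀ y ∈ K, 0 < f (y, 0)) {y₁ : X} (hy₁ : y₁ ∈ K) (ht₁ : 0 ≤ t₁) (h1 : f (y₁, t₁) ≤ 0) :
    ∃ y ∈ K, ∃ t ∈ Ioc 0 t₁, f (y, t) = 0 ∧ ∀ z ∈ K, ∀ s ∈ Icc 0 t, 0 ≤ f (z, s) := by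
  have hKc : IsCompact (K ×ˢ Icc (0 : ℝ) t₁) := hK.prod isCompact_Icc
  have hS : IsCompact (K ×ˢ Icc 0 t₁ ∩ f ⁻¹' Iic 0) :=
    hKc.of_isClosed_subset (hf.preimage_isClosed_of_isClosed hKc.isClosed isClosed_Iic)
      inter_subset_left
  -- The first zero minimises time over the compact set where `f ≤ 0`.
  obtain ⟨⟨y, t⟩, ⟨⟨hy, ht⟩, hft⟩, hmin⟩ := hS.exists_isMinOn
    ⟨(y₁, t₁), ⟨hy₁, ht₁, le_rfl⟩, h1⟩ continuous_snd.continuousOn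
  simp only at hy ht
  have hft' : f (y, t) ≤ 0 := hft
  have htpos : 0 < t := by
    rcases ht.1.eq_or_lt with h | h
    · subst h
      exact absurd hft' (not_le.2 (h0 y hy))
    · exact h
  have hbefore : ∀ z ∈ K, ∀ s ∈ Ico 0 t, 0 < f (z, s) := by
    intro z hz s hs
    by_contra! hle
    have : t ≤ s := hmin (a := (z, s)) ⟨⟨hz, hs.1, hs.2.le.trans ht.2⟩, hle⟩
    exact absurd hs.2 (not_lt.2 this)
  have hall : ∀ z ∈ K, ∀ s ∈ Icc 0 t, 0 ≤ f (z, s) := by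
    intro z hz s hs
    rcases hs.2.lt_or_eq with h | rfl
    · exact (hbefore z hz s ⟨hs.1, h⟩).le
    have hc : ContinuousOn (fun r => f (z, r)) (Icc 0 t₁) :=
      hf.comp (Continuous.continuousOn (by fun_prop)) fun r hr => ⟨hz, hr⟩
    have ht' : Tendsto (fun r => f (z, r)) (𝓝[Ioo 0 s] s) (𝓝 (f (z, s))) :=
      (hc s ht).mono_left (nhdsWithin_mono _ fun r hr => ⟨hr.1.le, hr.2.le.trans ht.2⟩)
    have := right_nhdsWithin_Ioo_neBot htpos
    refine ge_of_tendsto ht' ?_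
    filter_upwards [self_mem_nhdsWithin] with r hr
    exact (hbefore z hz r ⟨hr.1.le, hr.2⟩).le
  exact ⟨y, hy, t, ⟨htpos, ht.2⟩, le_antisymm hft' (hall y hy t ⟨ht.1, le_rfl⟩), hall⟩

/-- Only difference quotients from the left are used, so `t` may be the last time considered. -/
lemma hasDerivWithinAt_nonpos_of_right_zero {φ : ℝ → ℝ} {φ' t : ℝ} {I : Set ℝ}
    (h : HasDerivWithinAt φ φ' I t) (hI : Icc 0 t ⊆ I) (ht : 0 < t)
    (hnn : ∀ s ∈ Icc 0 t, 0 ≤ φ s) (h0 : φ t = 0) : φ' ≤ 0 := by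
  have h1 : HasDerivWithinAt φ φ' (Ioo 0 t) t := h.mono (Ioo_subset_Icc_self.trans hI)
  rw [hasDerivWithinAt_iff_tendsto_slope' (by simp)] at h1
  have := right_nhdsWithin_Ioo_neBot ht
  refine le_of_tendsto h1 ?_
  filter_upwards [self_mem_nhdsWithin] with s hs
  rw [slope_def_field, h0, sub_zero]
  exact div_nonpos_of_nonneg_of_nonpos (hnn s ⟨hs.1.le, hs.2.le⟩) (by linarith [hs.2])

/-- The constant `C_m`. -/
noncomputable def yamabeConst (m : ℕ) : ℝ := ((m : ℝ) - 1) * (2048 * ((m : ℝ) + 2) ^ 18)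

lemma yamabeConst_pos (hm : 3 ≤ m) : 0 < yamabeConst m := by
  have : (3 : ℝ) ≤ m := by exact_mod_cast hm
  exact mul_pos (by linarith) (by positivity)

/-- The spatial profile of the barrier centred at `x`. -/
noncomputable def barrier (x y : Coord m) : ℝ :=
  (1 - 64 / (1 - ‖x‖ ^ 2) ^ 2 * ‖y - x‖ ^ 2) ^ 16 * (4 / (1 - ‖y‖ ^ 2) ^ 2)

lemma log_barrier {x y : Coord m} (h1 : 0 < 1 - 64 / (1 - ‖x‖ ^ 2) ^ 2 * ‖y - x‖ ^ 2)
    (h2 : 0 < 1 - ‖y‖ ^ 2) :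
    Real.log (barrier x y) = barrierLog (64 / (1 - ‖x‖ ^ 2) ^ 2) x y + Real.log 4 := by
  rw [barrier, barrierLog, Real.log_mul (pow_pos h1 16).ne' (by positivity),
    Real.log_div (by norm_num) (by positivity), Real.log_pow, Real.log_pow]
  simp only [one_mul, sub_zero]
  push_cast
  ring

lemma barrier_cutoff_nonneg {x y : Coord m} (hx : x ∈ hypSpace m)
    (hy : ‖y - x‖ ≤ (1 - ‖x‖ ^ 2) / 8) : 0 ≤ 1 - 64 / (1 - ‖x‖ ^ 2) ^ 2 * ‖y - x‖ ^ 2 := by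
  have hA := one_sub_norm_sq_pos hx
  rw [sub_nonneg, div_mul_eq_mul_div, div_le_one (by positivity)]
  nlinarith [norm_nonneg (y - x)]

lemma norm_sub_lt_of_cutoff_pos {x y : Coord m} (hx : x ∈ hypSpace m)
    (h : 0 < 1 - 64 / (1 - ‖x‖ ^ 2) ^ 2 * ‖y - x‖ ^ 2) : ‖y - x‖ < (1 - ‖x‖ ^ 2) / 8 := by
  have hA := one_sub_norm_sq_pos hx
  rw [sub_pos, div_mul_eq_mul_div, div_lt_one (by positivity)] at h
  refine lt_of_pow_lt_pow_left₀ 2 (by positivity) ?_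
  nlinarith

/-- At a spatial touching point from above, `e^L δ` has at least the Yamabe speed of the
barrier. -/
lemma yamabe_speed_gt_of_touching (hm : 3 ≤ m) {x y : Coord m} (hx : x ∈ hypSpace m) {c : ℝ}
    {v : Coord m → ℝ} (hv : ContDiffAt ℝ 2 (fun z => Real.log (v z)) y) (hc : 0 < c)
    (hcut : 0 < 1 - 64 / (1 - ‖x‖ ^ 2) ^ 2 * ‖y - x‖ ^ 2)
    (hge : ∀ z, ‖z - x‖ ≤ (1 - ‖x‖ ^ 2) / 8 → c * barrier x z ≤ v z)
    (heq : v y = c * barrier x y) :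
    -(yamabeConst m * barrier x y) < (m - 1) * (∑ i, pd i (pd i (fun y => Real.log (v y))) y
      + (m - 2) / 4 * ∑ i, pd i (fun y => Real.log (v y)) y ^ 2) := by
  set κ := 64 / (1 - ‖x‖ ^ 2) ^ 2 with hκ
  have hm' : (3 : ℝ) ≤ m := by exact_mod_cast hm
  have hlt := norm_sub_lt_of_cutoff_pos hx hcut
  obtain ⟨hyS, -, hBA⟩ := one_sub_norm_sq_comparable hx hlt.le
  have hB := one_sub_norm_sq_pos hyS
  have hlog : ∀ z, 0 < 1 - κ * ‖z - x‖ ^ 2 → 0 < 1 - ‖z‖ ^ 2 →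
      0 < c * barrier x z ∧
        Real.log (c * barrier x z) = Real.log c + (barrierLog κ x z + Real.log 4) := by
    intro z h1 h2
    have hb : 0 < barrier x z := mul_pos (pow_pos h1 16) (by positivity)
    exact ⟨mul_pos hc hb, by rw [Real.log_mul hc.ne' hb.ne', log_barrier h1 h2]⟩
  -- The constants `log c` and `log 4` cancel in the comparison, so the size of `c` plays no role.
  have hmin : IsLocalMin (fun z => Real.log (v z) - barrierLog κ x z) y := by
    have c1 : Continuous fun z : Coord m => 1 - κ * ‖z - x‖ ^ 2 := by fun_prop
    have c2 : Continuous fun z : Coord m => 1 - ‖z‖ ^ 2 := by fun_prop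
    filter_upwards [c1.continuousAt.eventually (lt_mem_nhds hcut),
      c2.continuousAt.eventually (lt_mem_nhds hB)] with z hz1 hz2
    obtain ⟨hp, hl⟩ := hlog z hz1 hz2
    have h1 := Real.log_le_log hp (hge z (norm_sub_lt_of_cutoff_pos hx hz1).le)
    rw [hl] at h1
    rw [heq, (hlog y hcut hB).2]
    linarith
  have hcmp := pd_comparison_of_isLocalMin hv (contDiffAt_barrierLog hcut hB) hmin
  have hop := barrierLog_operator_ge hm hcut hB
  have hsc := barrier_scalar_inequality (M := (m : ℝ) + 2) (by linarith) (one_sub_norm_sq_pos hx)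
    hB hBA hcut
  have hle : ∑ k, pd k (pd k (barrierLog κ x)) y
        + ((m : ℝ) - 2) / 4 * ∑ k, pd k (barrierLog κ x) y ^ 2
      ≤ ∑ i, pd i (pd i (fun y => Real.log (v y))) y
      + (m - 2) / 4 * ∑ i, pd i (fun y => Real.log (v y)) y ^ 2 := by
    have e : ∀ i, pd i (fun y => Real.log (v y)) y = pd i (barrierLog κ x) y :=
      fun i => (hcmp i).1
    simp only [e]
    gcongr with i
    exact (hcmp i).2
  have hfin := hsc.trans_le (hop.trans hle)
  calc -(yamabeConst m * barrier x y)
      = (m - 1) * -(2048 * ((m : ℝ) + 2) ^ 18 * ((1 - κ * ‖y - x‖ ^ 2) ^ 16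
        * (4 / (1 - ‖y‖ ^ 2) ^ 2))) := by rw [yamabeConst, barrier]; ring
    _ < _ := mul_lt_mul_of_pos_left hfin (by linarith)

/-- Lower bound at the centre of a Euclidean ball contained in the domain of the flow. -/
theorem lower_bound_of_initial_lower_bound (m : ℕ) (hm : 3 ≤ m)
    (Ω : Set (Coord m)) (hΩ : IsOpen Ω) (hΩS : Ω ⊆ hypSpace m)
    (T : EReal) (g : ℝ → MetricField m) (hg : IsYamabeFlow Ω T g) (u : Coord m → ℝ → ℝ)
    (hu : ∀ t ∈ timeInterval T, ∀ x ∈ Ω, g t x = u x t • hypMetric m x)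
    (x : Coord m) (hx : x ∈ hypSpace m)
    (hK : Metric.closedBall x ((1 - ‖x‖ ^ 2) / 8) ⊆ Ω) (I : ℝ)
    (h0 : ∀ y ∈ Metric.closedBall x ((1 - ‖x‖ ^ 2) / 8), I < u y 0)
    (t : ℝ) (ht : t ∈ timeInterval T) : I - yamabeConst m * t ≤ u x t := by
  by_contra! hlt
  have hm' : (3 : ℝ) ≤ m := by exact_mod_cast hm
  let i₀ : Fin m := ⟨0, by omega⟩
  -- No regularity of `u` is given; a diagonal entry of `g` inherits both the smoothness and the
  -- flow equation.
  set v : ℝ → Coord m → ℝ := fun s y => g s y i₀ i₀ with hv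
  have hsub : Icc 0 t ⊆ timeInterval T := fun s hs =>
    ⟨hs.1, lt_of_le_of_lt (EReal.coe_le_coe_iff.2 hs.2) ht.2⟩
  have h0T : (0 : ℝ) ∈ timeInterval T := hsub ⟨le_rfl, ht.1⟩
  have hvu : ∀ s ∈ timeInterval T, ∀ y ∈ Ω, v s y = u y s * (4 / (1 - ‖y‖ ^ 2) ^ 2) := by
    intro s hs y hy
    simp [hv, hu s hs y hy, hypMetric]
  have hgv : ∀ s ∈ timeInterval T, ∀ y ∈ Ω,
      g s y = v s y • (1 : Matrix (Fin m) (Fin m) ℝ) := by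
    intro s hs y hy
    rw [hvu s hs y hy, hu s hs y hy, hypMetric, smul_smul]
  have hvpos : ∀ s ∈ timeInterval T, ∀ y ∈ Ω, 0 < v s y := fun s hs y hy =>
    (hg.posDef s hs y hy).diag_pos
  set K := Metric.closedBall x ((1 - ‖x‖ ^ 2) / 8) with hKdef
  have hA := one_sub_norm_sq_pos hx
  have hxK : x ∈ K := Metric.mem_closedBall_self (by linarith)
  have hcut : ∀ y ∈ K, 0 ≤ 1 - 64 / (1 - ‖x‖ ^ 2) ^ 2 * ‖y - x‖ ^ 2 := fun y hy =>
    barrier_cutoff_nonneg hx (mem_closedBall_iff_norm.1 hy)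
  have hbc : ContinuousOn (barrier x) K := by
    refine ContinuousOn.mul (Continuous.continuousOn (by fun_prop)) ?_
    refine continuousOn_const.div (Continuous.continuousOn (by fun_prop)) fun y hy => ?_
    exact (pow_pos (one_sub_norm_sq_pos (hΩS (hK hy))) 2).ne'
  have hfc : ContinuousOn (fun z : Coord m × ℝ => v z.2 z.1
      - (I - yamabeConst m * z.2) * barrier x z.1) (K ×ˢ Icc 0 t) := by
    refine ContinuousOn.sub ((hg.continuousOn i₀ i₀).mono (prod_mono hK hsub)) ?_
    refine ContinuousOn.mul (Continuous.continuousOn (by fun_prop)) ?_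
    exact hbc.comp continuousOn_fst fun z hz => hz.1
  have hinit : ∀ y ∈ K, 0 < v 0 y - (I - yamabeConst m * 0) * barrier x y := by
    intro y hy
    have hyB : 0 < 4 / (1 - ‖y‖ ^ 2) ^ 2 := by
      have := one_sub_norm_sq_pos (hΩS (hK hy))
      positivity
    have hvp := hvpos 0 h0T y (hK hy)
    rw [hvu 0 h0T y (hK hy)] at hvp ⊢
    have hup : 0 < u y 0 := (mul_pos_iff_of_pos_right hyB).1 hvp
    set η := 1 - 64 / (1 - ‖x‖ ^ 2) ^ 2 * ‖y - x‖ ^ 2 with hη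
    have hη0 : 0 ≤ η := hcut y hy
    have hη1 : η ≤ 1 := sub_le_self _ (by positivity)
    have hp0 : 0 ≤ η ^ 16 := pow_nonneg hη0 16
    have hp1 : η ^ 16 ≤ 1 := pow_le_one₀ hη0 hη1
    have hI := h0 y hy
    have hlt : I * η ^ 16 < u y 0 := by
      -- For `I ≤ 0` positivity of `u` suffices; for `I > 0` the cutoff only lowers the barrier.
      rcases le_or_gt I 0 with h | h
      · nlinarith
      · nlinarith
    have := mul_lt_mul_of_pos_right hlt hyB
    simp only [barrier, ← hη]
    linarith
  have hend : v t x - (I - yamabeConst m * t) * barrier x x ≤ 0 := by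
    have hb : barrier x x = 4 / (1 - ‖x‖ ^ 2) ^ 2 := by simp [barrier]
    rw [hvu t ht x (hK hxK), hb, ← sub_mul]
    exact mul_nonpos_of_nonpos_of_nonneg (by linarith) (by positivity)
  obtain ⟨y, hy, s, hs, hzero, hnn⟩ :=
    exists_first_zero (isCompact_closedBall x _) hfc hinit hxK ht.1 hend
  simp only at hzero hnn
  have hsT : s ∈ timeInterval T := hsub ⟨hs.1.le, hs.2⟩
  have hyΩ := hK hy
  -- At contact the barrier equals `v > 0`. This forces `I - C_m s > 0` and, since the barrier
  -- vanishes with the cutoff, places the contact point in the interior of `K`.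
  have hpos : 0 < (I - yamabeConst m * s) * barrier x y := by
    linarith [hvpos s hsT y hyΩ]
  have hb0 : 0 ≤ barrier x y := mul_nonneg (pow_nonneg (hcut y hy) 16) (by positivity)
  have hbpos : 0 < barrier x y := lt_of_le_of_ne hb0 fun h => by simp [← h] at hpos
  have hcpos : 0 < I - yamabeConst m * s := (mul_pos_iff_of_pos_right hbpos).1 hpos
  have hcutpos : 0 < 1 - 64 / (1 - ‖x‖ ^ 2) ^ 2 * ‖y - x‖ ^ 2 :=
    lt_of_le_of_ne (hcut y hy) fun h => by simp [barrier, ← h] at hbpos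
  have hC2 : ContDiffOn ℝ 2 (v s) Ω := hg.contDiffOn s hsT i₀ i₀
  have hlogC2 : ∀ z ∈ Ω, ContDiffAt ℝ 2 (fun z => Real.log (v s z)) z := fun z hz =>
    (hC2.contDiffAt (hΩ.mem_nhds hz)).log (hvpos s hsT z hz).ne'
  have hspeed := yamabe_speed_gt_of_touching hm hx (hlogC2 y hyΩ) hcpos hcutpos
    (fun z hz => sub_nonneg.1 (hnn z (mem_closedBall_iff_norm.2 hz) s ⟨hs.1.le, le_rfl⟩))
    (sub_eq_zero.1 hzero)
  have hR := scalarCurvature_conformal hΩ (hgv s hsT) (hvpos s hsT)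
    (hC2.differentiableOn two_ne_zero)
    (fun i z hz => ContDiffAt.differentiableAt_pd (hlogC2 z hz) i) hyΩ
  rw [← hR] at hspeed
  have hder : HasDerivWithinAt (fun r => v r y - (I - yamabeConst m * r) * barrier x y)
      (-scalarCurvature (g s) y * v s y - (-(yamabeConst m * 1)) * barrier x y)
      (timeInterval T) s := by
    refine (hg.equation s hsT y hyΩ i₀ i₀).fun_sub (HasDerivAt.hasDerivWithinAt ?_)
    exact (((hasDerivAt_id s).const_mul _).const_sub I).mul_const _
  have := hasDerivWithinAt_nonpos_of_right_zero hder
    (fun r hr => hsub ⟨hr.1, hr.2.trans hs.2⟩) hs.1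
    (fun r hr => hnn y hy r hr) hzero
  linarith

end YamabeHyp

theorem lemma5 (m : ℕ) (hm : 3 ≤ m) :
    ∃ C : ℝ, 0 < C ∧
      ∀ (Ω : Set (YamabeHyp.Coord m)) (_ : IsOpen Ω) (_ : Ω ⊆ YamabeHyp.hypSpace m)
        (p : YamabeHyp.Coord m) (_ : p ∈ YamabeHyp.hypSpace m)
        (r₀ : ℝ) (_ : 1 < r₀) (_ : YamabeHyp.hypBall m p r₀ ⊆ Ω)
        (T : EReal) (g : ℝ → YamabeHyp.MetricField m) (_ : YamabeHyp.IsYamabeFlow Ω T g)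
        (u : YamabeHyp.Coord m → ℝ → ℝ)
        (_ : ∀ t ∈ YamabeHyp.timeInterval T, ∀ x ∈ Ω,
          g t x = u x t • YamabeHyp.hypMetric m x),
        ∀ t ∈ YamabeHyp.timeInterval T, ∀ x ∈ YamabeHyp.hypBall m p (r₀ - 1),
          sInf ((fun y => u y 0) '' YamabeHyp.hypBall m p r₀) - C * t ≤ u x t := by
  refine ⟨YamabeHyp.yamabeConst m, YamabeHyp.yamabeConst_pos hm, ?_⟩
  intro Ω hΩ hΩS p hp r₀ _ hball T g hg u hu t ht x hx
  have hK : ∀ y ∈ Metric.closedBall x ((1 - ‖x‖ ^ 2) / 8), y ∈ YamabeHyp.hypBall m p r₀ :=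
    fun y hy => YamabeHyp.mem_hypBall_of_norm_sub_le hp hx (mem_closedBall_iff_norm.1 hy)
  have h0T : (0 : ℝ) ∈ YamabeHyp.timeInterval T :=
    ⟨le_rfl, lt_of_le_of_lt (EReal.coe_le_coe_iff.2 ht.1) ht.2⟩
  -- Positive definiteness gives `u > 0`, so the real-valued `sInf` is a genuine lower bound.
  have hbdd : BddBelow ((fun y => u y 0) '' YamabeHyp.hypBall m p r₀) := by
    refine ⟨0, ?_⟩
    rintro _ ⟨y, hy, rfl⟩
    have hd := (hg.posDef 0 h0T y (hball hy)).diag_pos (i := ⟨0, by omega⟩)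
    have hB := YamabeHyp.one_sub_norm_sq_pos (hΩS (hball hy))
    rw [hu 0 h0T y (hball hy)] at hd
    simp only [YamabeHyp.hypMetric, Matrix.smul_apply, Matrix.one_apply_eq, smul_eq_mul,
      mul_one] at hd
    exact ((mul_pos_iff_of_pos_right (by positivity)).1 hd).le
  rw [sub_le_iff_le_add]
  -- The barrier must start strictly below `v`, so the infimum is approached from below.
  refine le_of_forall_lt fun I hI => ?_
  obtain ⟨I', hI1, hI2⟩ := exists_between hI
  have := YamabeHyp.lower_bound_of_initial_lower_bound m hm Ω hΩ hΩS T g hg u hu x hx.1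
    (fun y hy => hball (hK y hy)) I'
    (fun y hy => hI2.trans_le (csInf_le hbdd ⟨y, hK y hy, rfl⟩)) t ht
  linarith
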